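/- Let $\sigma_0,\sigma_1$ be any two density matrices of the same finite dimension (positive semidefinite complex matrices of trace one), and let $\sigma_+=\tfrac12(\sigma_0+\sigma_1)$. Let $\Delta(\rho,\sigma)=\tfrac12\operatorname{tr}|\rho-\sigma|$, where $|A|=\sqrt{A^\dagger A}$, denote the trace distance, and let $F(\rho,\sigma)=\operatorname{tr}\sqrt{\rho^{1/2}\sigma\rho^{1/2}}$ denote the fidelity. Then $$\frac12\Big(F^2(\sigma_+,\sigma_0)+F^2(\sigma_+,\sigma_1)\Big)\ \ge\ \Big(1-\big(1-\tfrac1{\sqrt2}\big)\Delta(\sigma_0,\sigma_1)\Big)^2 .$$ -/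

import Mathlib

namespace QuantumState

open scoped MatrixOrder ComplexOrder

variable {n : Type*} [Fintype n]

/-- A quantum state (density matrix): a positive semidefinite complex matrix of trace one. -/
structure IsDensityMatrix (ρ : Matrix n n ℂ) : Prop where
  posSemidef : ρ.PosSemidef
  trace_eq_one : ρ.trace = 1

variable [DecidableEq n]

/-- Trace distance `Δ(ρ, σ) = (1/2) tr |ρ - σ|` with `|A| = √(Aᴴ A)`. The trace of `|ρ - σ|`
is a nonnegative real number, so that taking its real part loses nothing. -/
noncomputable def traceDistance (ρ σ : Matrix n n ℂ) : ℝ :=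
  (1 / 2) * (CFC.abs (ρ - σ)).trace.re

/-- Fidelity `F(ρ, σ) = tr √(√ρ σ √ρ)` (not squared). The square roots are the positive
semidefinite ones, and the trace is a nonnegative real number for states `ρ` and `σ`. -/
noncomputable def fidelity (ρ σ : Matrix n n ℂ) : ℝ :=
  (CFC.sqrt (CFC.sqrt ρ * σ * CFC.sqrt ρ)).trace.re

end QuantumState

namespace QuantumState

open scoped MatrixOrder ComplexOrder
open Matrix

variable {n : Type*} [Fintype n] [DecidableEq n]

/-! Each of the two fidelities separately is at least `1 - (1 - 1/√2) Δ`; nonnegativity of this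
bound (`traceDistance_le_one`) then allows squaring and averaging. For `ρ = (σ + τ)/2`, measuring in
an eigenbasis of the Fuchs–Caves operator `M` (`exists_fuchsCaves`) turns the fidelity of `ρ` and
`σ` into a classical one, `∑ √(pᵢ (pᵢ + δᵢ))`, where `pᵢ` and `2δᵢ` are the diagonal entries of `ρ`
and `σ - τ`. Each summand is concave in `δᵢ ∈ [-pᵢ, pᵢ]`, so it lies above its chords on either side
of `0` (`chord_le_mul`). On summing, the part linear in `δᵢ` cancels because the traces agree, and
`∑ |δᵢ| ≤ Δ` by pinching (`abs_conj_diag_le`). -/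

/-- A Hermitian matrix has a Hermitian generalized inverse commuting with it. -/
lemma exists_hermitian_pseudoInverse {R : Matrix n n ℂ} (hR : R.IsHermitian) :
    ∃ G : Matrix n n ℂ, G.IsHermitian ∧ R * G * R = R ∧ G * R = R * G := by
  have hR' : IsSelfAdjoint R := hR
  have hc (f : ℝ → ℝ) : ContinuousOn f (spectrum ℝ R) := R.finite_real_spectrum.continuousOn f
  refine ⟨cfc (fun x : ℝ => x⁻¹) R, cfc_predicate (R := ℝ) (p := IsSelfAdjoint) _ R, ?_, ?_⟩
  · calc R * cfc (fun x : ℝ => x⁻¹) R * R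
        = cfc (fun x : ℝ => x) R * cfc (fun x : ℝ => x⁻¹) R * cfc (fun x : ℝ => x) R := by
          rw [cfc_id' ℝ R]
      _ = cfc (fun x : ℝ => x) R := by
          rw [← cfc_mul _ _ R (hc _) (hc _), ← cfc_mul _ _ R (hc _) (hc _)]
          exact cfc_congr fun x _ => mul_inv_mul_cancel x
      _ = R := cfc_id' ℝ R
  · have h := (cfc_commute_cfc (fun x : ℝ => x⁻¹) (fun x : ℝ => x) R).eq
    rwa [cfc_id' ℝ R] at h

/-- If `A` is positive semidefinite and `Bᴴ * A * B = 0`, then `A * B = 0`. -/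
lemma mul_eq_zero_of_conj_eq_zero {A B : Matrix n n ℂ} (hA : A.PosSemidef)
    (h : Bᴴ * A * B = 0) : A * B = 0 := by
  have h0 : 0 ≤ A := nonneg_iff_posSemidef.2 hA
  have hs : (CFC.sqrt A)ᴴ = CFC.sqrt A := (nonneg_iff_posSemidef.1 (CFC.sqrt_nonneg A)).isHermitian
  have hz : (CFC.sqrt A * B)ᴴ * (CFC.sqrt A * B) = 0 := by
    rw [conjTranspose_mul, hs, ← h]
    nth_rewrite 3 [← CFC.sqrt_mul_sqrt_self A h0]
    simp only [mul_assoc]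
  rw [conjTranspose_mul_self_eq_zero] at hz
  rw [← CFC.sqrt_mul_sqrt_self A h0, mul_assoc, hz, mul_zero]

/-- If `σ ≤ c ρ`, then the Fuchs–Caves operator `M` maps `ρ` to `σ` and has mean the fidelity. -/
lemma exists_fuchsCaves {ρ σ : Matrix n n ℂ} (hρ : ρ.PosSemidef) (hσ : σ.PosSemidef) {c : ℂ}
    (hle : σ ≤ c • ρ) :
    ∃ M : Matrix n n ℂ, M.PosSemidef ∧ M * ρ * M = σ ∧ (ρ * M).trace.re = fidelity ρ σ := by
  have hRp : (CFC.sqrt ρ).PosSemidef := nonneg_iff_posSemidef.1 (CFC.sqrt_nonneg ρ)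
  have hRR : CFC.sqrt ρ * CFC.sqrt ρ = ρ :=
    CFC.sqrt_mul_sqrt_self ρ (nonneg_iff_posSemidef.2 hρ)
  unfold fidelity
  generalize CFC.sqrt ρ = R at hRp hRR ⊢
  have hRh : Rᴴ = R := hRp.isHermitian
  obtain ⟨G, hG, hRGR, hGR⟩ := exists_hermitian_pseudoInverse hRp.isHermitian
  have hGh : Gᴴ = G := hG
  have hXp : (R * σ * R).PosSemidef := by simpa [hRh] using hσ.mul_mul_conjTranspose_same R
  have hTp : (CFC.sqrt (R * σ * R)).PosSemidef := nonneg_iff_posSemidef.1 (CFC.sqrt_nonneg _)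
  have hTT : CFC.sqrt (R * σ * R) * CFC.sqrt (R * σ * R) = R * σ * R :=
    CFC.sqrt_mul_sqrt_self _ (nonneg_iff_posSemidef.2 hXp)
  generalize CFC.sqrt (R * σ * R) = T at hTp hTT ⊢
  have hTh : Tᴴ = T := hTp.isHermitian
  -- `1 - R * G` is the orthogonal projection onto the kernel of `R`. The bound `σ ≤ c ρ` forces `σ`
  -- to vanish there, and `T` vanishes there because `T * T = R * σ * R`.
  have hRQ : R * (1 - R * G) = 0 := by rw [mul_sub, mul_one, ← hGR, ← mul_assoc, hRGR, sub_self]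
  have hσQ : σ * (1 - R * G) = 0 := by
    apply mul_eq_zero_of_conj_eq_zero hσ
    apply le_antisymm
    · have := (le_iff.1 hle).conjTranspose_mul_mul_same (1 - R * G)
      rw [← nonneg_iff_posSemidef, mul_sub _ (c • ρ), sub_mul, sub_nonneg] at this
      refine this.trans_eq ?_
      rw [← hRR, mul_smul_comm, smul_mul_assoc, mul_assoc, mul_assoc R, hRQ]
      simp
    · exact nonneg_iff_posSemidef.2 (hσ.conjTranspose_mul_mul_same _)
  have hTQ : T * (1 - R * G) = 0 := by
    have : (T * (1 - R * G))ᴴ * (T * (1 - R * G)) = 0 := by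
      rw [conjTranspose_mul, hTh, mul_assoc, ← mul_assoc T, hTT, mul_assoc (R * σ), hRQ]
      simp
    rwa [conjTranspose_mul_self_eq_zero] at this
  have hσP : σ * (R * G) = σ := by rw [mul_sub, mul_one, sub_eq_zero] at hσQ; exact hσQ.symm
  have hPσ : G * R * σ = σ := by
    have := congrArg conjTranspose hσP
    rw [conjTranspose_mul, conjTranspose_mul, hGh, hRh, hσ.isHermitian.eq] at this
    exact this
  have hTP : T * (R * G) = T := by rw [mul_sub, mul_one, sub_eq_zero] at hTQ; exact hTQ.symm
  -- With `G` in the role of `ρ^(-1/2)`, this is `ρ^(-1/2) (ρ^(1/2) σ ρ^(1/2))^(1/2) ρ^(-1/2)`.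
  refine ⟨G * T * G, by simpa [hGh] using hTp.mul_mul_conjTranspose_same G, ?_, ?_⟩
  · calc G * T * G * ρ * (G * T * G)
        = G * (T * ((G * R) * (R * G))) * T * G := by rw [← hRR]; simp only [mul_assoc]
      _ = G * (T * T) * G := by rw [hGR, ← mul_assoc T, hTP, hTP]; simp only [mul_assoc]
      _ = (G * R * σ) * (R * G) := by rw [hTT]; simp only [mul_assoc]
      _ = σ := by rw [hPσ, hσP]
  · congr 1
    calc (ρ * (G * T * G)).trace = (G * ρ * G * T).trace := by
          rw [← mul_assoc, trace_mul_comm]; simp only [mul_assoc]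
      _ = (T * ((G * R) * (R * G))).trace := by
          rw [trace_mul_comm, ← hRR]; simp only [mul_assoc]
      _ = T.trace := by rw [hGR, ← mul_assoc, hTP, hTP]

/-- Scalar form of the bound: the square root of `p (p + d)` lies above its chords on `|d| ≤ p`. -/
lemma chord_le_mul {m p d : ℝ} (hm : 0 ≤ m) (hd : |d| ≤ p) (h : m ^ 2 * p = p + d) :
    p + 1 / Real.sqrt 2 * d - (1 - 1 / Real.sqrt 2) * |d| ≤ m * p := by
  have hp : 0 ≤ p := (abs_nonneg d).trans hd
  have hq : 1 / Real.sqrt 2 = Real.sqrt 2 / 2 := by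
    field_simp
    norm_num
  rw [hq]
  have h2 : Real.sqrt 2 ^ 2 = 2 := Real.sq_sqrt (by norm_num)
  have h1 : 1 ≤ Real.sqrt 2 := Real.one_le_sqrt.2 (by norm_num)
  generalize Real.sqrt 2 = r at h1 h2
  have hmp : (m * p) ^ 2 = p * (p + d) := by rw [← h]; ring
  rcases abs_cases d with ⟨ha, h0⟩ | ⟨ha, h0⟩ <;> rw [ha] at hd ⊢
  · refine abs_le_of_sq_le_sq' ?_ (mul_nonneg hm hp) |>.2
    -- For `d ≥ 0` the chord is `p + (√2 - 1) d`, joining `d = 0` to `d = p`; the last term vanishes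
    -- since `r ^ 2 = 2`.
    have e : (p + r / 2 * d - (1 - r / 2) * d) ^ 2 =
        p * (p + d) - (r - 1) ^ 2 * (d * (p - d)) + (r ^ 2 - 2) * p * d := by
      ring
    rw [hmp, e, h2]
    nlinarith [mul_nonneg (sq_nonneg (r - 1)) (mul_nonneg h0 (sub_nonneg.2 hd))]
  -- For `d < 0` the chord is `p + d`, and `(p + d) ^ 2 ≤ p (p + d)`.
  · refine abs_le_of_sq_le_sq' ?_ (mul_nonneg hm hp) |>.2
    rw [hmp]
    nlinarith

lemma trace_mul_nonneg {A B : Matrix n n ℂ} (hA : A.PosSemidef) (hB : B.PosSemidef) :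
    0 ≤ (A * B).trace.re := by
  have hs : (CFC.sqrt B)ᴴ = CFC.sqrt B := (nonneg_iff_posSemidef.1 (CFC.sqrt_nonneg B)).isHermitian
  rw [← CFC.sqrt_mul_sqrt_self B (nonneg_iff_posSemidef.2 hB), ← mul_assoc, trace_mul_comm,
    ← mul_assoc]
  have := (hA.mul_mul_conjTranspose_same (CFC.sqrt B)).trace_nonneg
  rw [hs] at this
  exact (Complex.le_def.1 this).1

/-- With `S` the sign of `ρ - σ`, `tr |ρ - σ| = tr Sρ - tr Sσ`, and `-1 ≤ S ≤ 1` bounds each of the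
two terms by `1`. -/
lemma traceDistance_le_one {ρ σ : Matrix n n ℂ} (hρ : IsDensityMatrix ρ)
    (hσ : IsDensityMatrix σ) : traceDistance ρ σ ≤ 1 := by
  have hA : IsSelfAdjoint (ρ - σ) := hρ.posSemidef.isHermitian.sub hσ.posSemidef.isHermitian
  have hc (f : ℝ → ℝ) : ContinuousOn f (spectrum ℝ (ρ - σ)) :=
    (ρ - σ).finite_real_spectrum.continuousOn f
  obtain ⟨S, hS, hlo, hhi⟩ : ∃ S : Matrix n n ℂ, CFC.abs (ρ - σ) = S * (ρ - σ) ∧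
      (1 + S).PosSemidef ∧ (1 - S).PosSemidef := by
    have h1 : (1 : Matrix n n ℂ) = cfc (fun _ : ℝ => (1 : ℝ)) (ρ - σ) :=
      (cfc_const_one ℝ (ρ - σ)).symm
    have hsign (x : ℝ) : -1 ≤ Real.sign x ∧ Real.sign x ≤ 1 := by
      rcases Real.sign_apply_eq x with h | h | h <;> norm_num [h]
    refine ⟨cfc Real.sign (ρ - σ), ?_, ?_, ?_⟩
    · have : cfc Real.sign (ρ - σ) * (ρ - σ) =
          cfc Real.sign (ρ - σ) * cfc (fun x : ℝ => x) (ρ - σ) := by rw [cfc_id' ℝ (ρ - σ)]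
      rw [this, ← cfc_mul _ _ _ (hc _) (hc _), CFC.abs_eq_cfc_norm (ρ - σ)]
      exact cfc_congr fun x _ => by
        rcases lt_trichotomy x 0 with h | h | h
        · simp [Real.sign_of_neg h, abs_of_neg h]
        · simp [h]
        · simp [Real.sign_of_pos h, abs_of_pos h]
    · rw [h1, ← cfc_add _ _ _ (hc _) (hc _), ← nonneg_iff_posSemidef]
      exact cfc_nonneg fun x _ => by linarith [hsign x]
    · rw [h1, ← cfc_sub _ _ _ (hc _) (hc _), ← nonneg_iff_posSemidef]
      exact cfc_nonneg fun x _ => by linarith [hsign x]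
  have e1 := trace_mul_nonneg hhi hρ.posSemidef
  have e2 := trace_mul_nonneg hlo hσ.posSemidef
  rw [sub_mul, one_mul, trace_sub, hρ.trace_eq_one] at e1
  rw [add_mul, one_mul, trace_add, hσ.trace_eq_one] at e2
  simp only [Complex.sub_re, Complex.add_re, Complex.one_re] at e1 e2
  rw [traceDistance, hS, mul_sub, trace_sub, Complex.sub_re]
  linarith

/-- Pinching: the diagonal of a Hermitian matrix in an orthonormal basis is dominated by that of
its absolute value. -/
lemma abs_conj_diag_le {A : Matrix n n ℂ} (hA : A.IsHermitian) (U : Matrix n n ℂ) (i : n) :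
    |((Uᴴ * A * U) i i).re| ≤ ((Uᴴ * CFC.abs A * U) i i).re := by
  have hA' : IsSelfAdjoint A := hA
  have key {B : Matrix n n ℂ} (hB : 0 ≤ B) : 0 ≤ ((Uᴴ * B * U) i i).re :=
    (Complex.le_def.1
      ((nonneg_iff_posSemidef.1 hB).conjTranspose_mul_mul_same U).diag_nonneg).1
  have h1 := key (B := CFC.abs A - A) (by
    rw [CFC.abs_sub_self A hA']; exact nsmul_nonneg (CFC.negPart_nonneg A) 2)
  have h2 := key (B := CFC.abs A + A) (by
    rw [CFC.abs_add_self A hA']; exact nsmul_nonneg (CFC.posPart_nonneg A) 2)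
  rw [mul_sub, sub_mul, Matrix.sub_apply, Complex.sub_re] at h1
  rw [mul_add, add_mul, Matrix.add_apply, Complex.add_re] at h2
  rw [abs_le]
  constructor <;> linarith

lemma trace_conj_unitary {U : Matrix n n ℂ} (hU : U * Uᴴ = 1) (A : Matrix n n ℂ) :
    ∑ i, ((Uᴴ * A * U) i i).re = A.trace.re := by
  rw [← Complex.re_sum]
  change (Uᴴ * A * U).trace.re = _
  rw [trace_mul_comm, ← mul_assoc, hU, one_mul]

lemma le_fidelity_midpoint {σ τ : Matrix n n ℂ} (hσ : IsDensityMatrix σ)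
    (hτ : IsDensityMatrix τ) :
    1 - (1 - 1 / Real.sqrt 2) * traceDistance σ τ ≤ fidelity ((1 / 2 : ℂ) • (σ + τ)) σ := by
  have hρ : ((1 / 2 : ℂ) • (σ + τ)).PosSemidef :=
    (hσ.posSemidef.add hτ.posSemidef).smul (by norm_num [Complex.le_def])
  -- The constant `2` works because `2ρ - σ = τ ≥ 0`.
  obtain ⟨M, hM, hMM, hF⟩ := exists_fuchsCaves hρ hσ.posSemidef (c := 2) (by
    rw [smul_smul]; norm_num; exact nonneg_iff_posSemidef.2 hτ.posSemidef)
  have hA : (σ - τ).IsHermitian := hσ.posSemidef.isHermitian.sub hτ.posSemidef.isHermitian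
  set U : Matrix n n ℂ := (hM.isHermitian.eigenvectorUnitary : Matrix n n ℂ) with hUdef
  have hU : U * Uᴴ = 1 := Unitary.coe_mul_star_self hM.isHermitian.eigenvectorUnitary
  have hU' : Uᴴ * U = 1 := Unitary.coe_star_mul_self hM.isHermitian.eigenvectorUnitary
  set m := hM.isHermitian.eigenvalues
  have hm (i : n) : 0 ≤ m i := hM.eigenvalues_nonneg i
  set L : Matrix n n ℂ := diagonal (fun i => (m i : ℂ)) with hL
  have hMU : M = U * L * Uᴴ := hM.isHermitian.spectral_theorem
  set p : n → ℝ := fun i => ((Uᴴ * ((1 / 2 : ℂ) • (σ + τ)) * U) i i).re with hp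
  set d : n → ℝ := fun i => ((Uᴴ * (σ - τ) * U) i i).re with hd
  have hσd (i : n) : ((Uᴴ * σ * U) i i).re = p i + d i / 2 := by
    simp [hp, hd, mul_add, add_mul, mul_sub, sub_mul]
    ring
  have hτd (i : n) : ((Uᴴ * τ * U) i i).re = p i - d i / 2 := by
    simp [hp, hd, mul_add, add_mul, mul_sub, sub_mul]
    ring
  have hdp (i : n) : |d i / 2| ≤ p i := by
    have h1 := (Complex.le_def.1
      ((hσ.posSemidef.conjTranspose_mul_mul_same U).diag_nonneg (i := i))).1
    have h2 := (Complex.le_def.1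
      ((hτ.posSemidef.conjTranspose_mul_mul_same U).diag_nonneg (i := i))).1
    rw [hσd] at h1
    rw [hτd] at h2
    rw [abs_le]
    constructor <;> simp at h1 h2 <;> linarith
  -- Diagonal entries of `M ρ M = σ` in the eigenbasis of `M`; hence `m i * p i` is the geometric
  -- mean of the outcome probabilities of `ρ` and `σ`.
  have hmp (i : n) : m i ^ 2 * p i = p i + d i / 2 := by
    rw [← hσd]
    have : Uᴴ * σ * U = L * (Uᴴ * ((1 / 2 : ℂ) • (σ + τ)) * U) * L := by
      nth_rewrite 1 [← hMM]
      calc _ = Uᴴ * M * ((1 / 2 : ℂ) • (σ + τ)) * (M * U) := by simp only [mul_assoc]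
        _ = (Uᴴ * U) * L * Uᴴ * ((1 / 2 : ℂ) • (σ + τ)) * (U * L * (Uᴴ * U)) := by
          rw [hMU]; simp only [mul_assoc]
        _ = _ := by rw [hU']; simp only [mul_assoc, one_mul, mul_one]
    rw [this, hL, mul_diagonal, diagonal_mul]
    simp only [hp, Complex.mul_re, Complex.ofReal_re, Complex.ofReal_im, Complex.mul_im]
    ring
  have hsumF : ∑ i, m i * p i = fidelity ((1 / 2 : ℂ) • (σ + τ)) σ := by
    rw [← hF, ← trace_conj_unitary hU]
    refine Finset.sum_congr rfl fun i _ => ?_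
    have : Uᴴ * ((1 / 2 : ℂ) • (σ + τ) * M) * U = (Uᴴ * ((1 / 2 : ℂ) • (σ + τ)) * U) * L := by
      calc _ = Uᴴ * ((1 / 2 : ℂ) • (σ + τ)) * U * L * (Uᴴ * U) := by
            rw [hMU]; simp only [mul_assoc]
        _ = _ := by rw [hU', mul_one]
    rw [this, hL, mul_diagonal]
    simp only [hp, Complex.mul_re, Complex.ofReal_re, Complex.ofReal_im]
    ring
  have hsump : ∑ i, p i = 1 := by
    rw [hp, trace_conj_unitary hU, trace_smul, trace_add, hσ.trace_eq_one, hτ.trace_eq_one]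
    norm_num
  have hsumd : ∑ i, d i = 0 := by
    rw [hd, trace_conj_unitary hU, trace_sub, hσ.trace_eq_one, hτ.trace_eq_one, sub_self]
    rfl
  have hsuma : ∑ i, |d i| ≤ 2 * traceDistance σ τ := by
    rw [traceDistance, ← trace_conj_unitary hU]
    refine (Finset.sum_le_sum fun i _ => abs_conj_diag_le hA U i).trans (le_of_eq ?_)
    ring
  have hβ : 0 ≤ 1 - 1 / Real.sqrt 2 := by
    rw [sub_nonneg, div_le_one (by positivity)]
    exact Real.one_le_sqrt.2 (by norm_num)
  calc 1 - (1 - 1 / Real.sqrt 2) * traceDistance σ τ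
      ≤ 1 - (1 - 1 / Real.sqrt 2) * ((∑ i, |d i|) / 2) := by
        gcongr; linarith
    _ = ∑ i, (p i + 1 / Real.sqrt 2 * (d i / 2) - (1 - 1 / Real.sqrt 2) * |d i / 2|) := by
        simp only [abs_div, abs_two]
        rw [Finset.sum_sub_distrib, Finset.sum_add_distrib, ← Finset.mul_sum, ← Finset.mul_sum,
          ← Finset.sum_div, ← Finset.sum_div, hsump, hsumd]
        ring
    _ ≤ ∑ i, m i * p i := Finset.sum_le_sum fun i _ => chord_le_mul (hm i) (hdp i) (hmp i)
    _ = _ := hsumF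

lemma traceDistance_comm (ρ σ : Matrix n n ℂ) : traceDistance ρ σ = traceDistance σ ρ := by
  rw [traceDistance, traceDistance, ← neg_sub σ ρ, CFC.abs_neg]

end QuantumState

theorem mainTheorem2 {n : Type*} [Fintype n] [DecidableEq n] (σ₀ σ₁ σp : Matrix n n ℂ)
    (h₀ : QuantumState.IsDensityMatrix σ₀) (h₁ : QuantumState.IsDensityMatrix σ₁)
    (hp : σp = (1 / 2 : ℂ) • (σ₀ + σ₁)) :
    (1 - (1 - 1 / Real.sqrt 2) * QuantumState.traceDistance σ₀ σ₁) ^ 2 ≤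
      (1 / 2) * (QuantumState.fidelity σp σ₀ ^ 2 + QuantumState.fidelity σp σ₁ ^ 2) := by
  subst hp
  have e₀ := QuantumState.le_fidelity_midpoint h₀ h₁
  have e₁ := QuantumState.le_fidelity_midpoint h₁ h₀
  rw [QuantumState.traceDistance_comm, add_comm σ₁ σ₀] at e₁
  have hΔ := QuantumState.traceDistance_le_one h₀ h₁
  have hs : 0 < 1 / Real.sqrt 2 := by positivity
  have hs' : 1 / Real.sqrt 2 ≤ 1 := by
    rw [div_le_one (by positivity)]
    exact Real.one_le_sqrt.2 (by norm_num)
  -- Squaring preserves the bounds only if their left side is nonnegative, which `Δ ≤ 1` ensures.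
  have hnn : 0 ≤ 1 - (1 - 1 / Real.sqrt 2) * QuantumState.traceDistance σ₀ σ₁ := by nlinarith
  have q₀ := pow_le_pow_left₀ hnn e₀ 2
  have q₁ := pow_le_pow_left₀ hnn e₁ 2
  linarith
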